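/- **Theorem 3.1 (Degree at most (1,1)).** Conventions. Let $\mathbb R_+=[0,\infty)$ and $\mathbb Z_+=\{0,1,2,\dots\}$. - A sequence $\{u_m\}_{m\in\mathbb Z_+}$ of reals is *completely monotone* if $(-1)^k(\triangle^k u)_m\ge 0$ for all $k,m\in\mathbb Z_+$, where $(\triangle u)_m=u_{m+1}-u_m$. - A net $\{u_{m,n}\}_{m,n\in\mathbb Z_+}$ of reals is *joint completely monotone* if $(-1)^{j+k}(\triangle_1^j\triangle_2^k u)_{m,n}\ge 0$ for all $j,k,m,n\in\mathbb Z_+$, where $\triangle_1,\triangle_2$ are the forward differences in the first and second index. It is *minimal* if, in addition, for every $\epsilon>0$ neither $\{u_{k,0}-\epsilon\mathbb 1_{\{0\}}(k)\}_{k}$ nor $\{u_{0,k}-\epsilon\mathbb 1_{\{0\}}(k)\}_{k}$ is a completely monotone sequence. - An infinitely differentiable function $f:\mathbb R_+^2\to(0,\infty)$ is *joint completely monotone* if $(-1)^{j+k}\partial_1^j\partial_2^k f\ge 0$ on $\mathbb R_+^2$ for all $j,k\in\mathbb Z_+$ (one-sided derivatives at the boundary). - The *representing measure* of a net $\{u_{m,n}\}$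 is the unique finite Borel measure $\mu$ concentrated on $[0,1]^2$ with $u_{m,n}=\int s^mt^n\,d\mu(s,t)$ for all $m,n\in\mathbb Z_+$. - $I_\nu(z)=\left(\frac z2\right)^\nu\sum_{k=0}^\infty\left(\frac{z^2}{4}\right)^k\frac{1}{k!\,\Gamma(\nu+k+1)}$ is the modified Bessel function of the first kind. Let $a,b,c,d\in\mathbb R$ be such that $p(x,y)=a+bx+cy+dxy>0$ for all $x,y\in\mathbb R_+$, and let $M=bc-ad$. The following are equivalent: 1. $\frac1p$ is a joint completely monotone function on $\mathbb R_+^2$; 2. $M\ge 0$; 3. $\left\{\frac1{p(m,n)}\right\}_{m,n\in\mathbb Z_+}$ is a joint completely monotone net; 4. $\left\{\frac1{p(m,n)}\right\}_{m,n\in\mathbb Z_+}$ is a minimal joint completely monotone net. If $M\ge 0$, then for every integer $l\ge 1$ the net $\left\{\frac1{p(m,n)^l}\right\}_{m,n\in\mathbb Z_+}$ is a minimal joint completely monotone net, and its representing measure is as follows. - If $d\ne 0$, it is $\omega_{M,l}(s,t)\,ds\,dt$ on $(0,1)^2$, where $$\omega_{M,l}(s,t)=\frac{s^{\frac cd-1}t^{\frac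 bd-1}}{d\,(l-1)!}\left(\frac{\log t\log s}{M}\right)^{\frac{l-1}2}I_{l-1}\!\left(\frac2d\sqrt{M\log s\log t}\right)\quad\text{for } M>0,$$ $$\omega_{0,l}(s,t)=\frac{s^{\frac cd-1}t^{\frac bd-1}}{d^l\,(l-1)!}\,\frac{(\log t\log s)^{l-1}}{(l-1)!}\quad\text{for } M=0.$$ - If $d=0$ and $b\ne 0$, it is $$\frac{(-1)^{l-1}}{b^l\,(l-1)!}(\log s)^{l-1}s^{\frac ab-1}\,d\delta_{s^{c/b}}(t)\,ds,\qquad s\in(0,1),$$ where $\delta_x$ is the unit point mass at $x$. Moreover, if $d\ne 0$ and $M\ge 0$, then, with $b,c,d$ fixed and $M$ regarded as a parameter in the above formulas for $\omega_{M,l}$, one has for every integer $l\ge 1$ and all $s,t\in(0,1)$ $$\lim_{M\to 0,\ M>0}\omega_{M,l}(s,t)=\omega_{0,l}(s,t).$$ -/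

import Mathlib

open Set Filter Topology MeasureTheory
open scoped ContDiff Nat

noncomputable section

/-- The polynomial `p(x, y) = a + b x + c y + d x y` of bi-degree at most `(1, 1)`. -/
def bidegOnePoly (a b c d x y : ℝ) : ℝ := a + b * x + c * y + d * x * y

/-- A sequence `u` is completely monotone if `(-1)^k (Δ^k u)(m) ≥ 0` for all `k, m`, where
`(Δ u)(m) = u (m + 1) - u m`. -/
def CompletelyMonotoneSeq (u : ℕ → ℝ) : Prop :=
  ∀ k m : ℕ, 0 ≤ (-1 : ℝ) ^ k * (fwdDiff 1)^[k] u m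

/-- A net `u` indexed by `ℤ₊²` is joint completely monotone if
`(-1)^(k + l) (Δ₁^k Δ₂^l u)(m, n) ≥ 0` for all `k, l, m, n`, where `Δ₁`, `Δ₂` are the forward
difference operators in the directions `(1, 0)` and `(0, 1)`. -/
def JointCompletelyMonotoneNet (u : ℕ × ℕ → ℝ) : Prop :=
  ∀ k l m n : ℕ,
    0 ≤ (-1 : ℝ) ^ (k + l) * (fwdDiff (1, 0))^[k] ((fwdDiff (0, 1))^[l] u) (m, n)

/-- A joint completely monotone net is minimal if, on each of the two coordinate axes, the
restricted sequence stops being completely monotone as soon as its zeroth term is decreased. -/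
def MinimalJointCompletelyMonotoneNet (u : ℕ × ℕ → ℝ) : Prop :=
  JointCompletelyMonotoneNet u ∧
    ∀ ε : ℝ, 0 < ε →
      (¬ CompletelyMonotoneSeq fun k => u (k, 0) - if k = 0 then ε else 0) ∧
      (¬ CompletelyMonotoneSeq fun k => u (0, k) - if k = 0 then ε else 0)

/-- The closed quadrant `ℝ₊²`. -/
def quadrant : Set (ℝ × ℝ) := Ici 0 ×ˢ Ici 0

/-- Partial derivative in the first variable of a function on `ℝ₊²` (one-sided at `x = 0`). -/
def partialFst (f : ℝ × ℝ → ℝ) (z : ℝ × ℝ) : ℝ :=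
  derivWithin (fun x => f (x, z.2)) (Ici 0) z.1

/-- Partial derivative in the second variable of a function on `ℝ₊²` (one-sided at `y = 0`). -/
def partialSnd (f : ℝ × ℝ → ℝ) (z : ℝ × ℝ) : ℝ :=
  derivWithin (fun y => f (z.1, y)) (Ici 0) z.2

/-- `f : ℝ₊² → (0, ∞)` is a joint completely monotone function: it is positive and infinitely
differentiable on `ℝ₊²`, and `(-1)^(k + l) ∂₁^k ∂₂^l f ≥ 0` on `ℝ₊²` for all `k, l`.
Only the values of `f` on `ℝ₊²` matter. -/
def JointCompletelyMonotoneFun (f : ℝ × ℝ → ℝ) : Prop :=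
  (∀ z ∈ quadrant, 0 < f z) ∧ ContDiffOn ℝ ∞ f quadrant ∧
    ∀ k l : ℕ, ∀ z ∈ quadrant, 0 ≤ (-1 : ℝ) ^ (k + l) * partialFst^[k] (partialSnd^[l] f) z

/-- `μ` is a representing measure of the net `u`: a finite Borel measure concentrated on
`[0, 1]²` (such a measure on the plane is automatically regular) whose moments are the terms
of `u`. -/
structure IsRepresentingMeasure (u : ℕ × ℕ → ℝ) (μ : Measure (ℝ × ℝ)) : Prop where
  finite : IsFiniteMeasure μ
  concentrated : μ (Icc 0 1 ×ˢ Icc 0 1)ᶜ = 0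
  moment : ∀ m n : ℕ, u (m, n) = ∫ z, z.1 ^ m * z.2 ^ n ∂μ

/-- The modified Bessel function of the first kind of real order `ν`, on positive reals `z`:
`I_ν(z) = (z/2)^ν ∑ₖ (z²/4)^k / (k! Γ(ν + k + 1))`. -/
def besselI (ν z : ℝ) : ℝ :=
  (z / 2) ^ ν * ∑' k : ℕ, (z ^ 2 / 4) ^ k / (k ! * Real.Gamma (ν + k + 1))

/-- The weight function `ω_{M, l}(s, t)` for `0 < s, t < 1`, `d ≠ 0`, `M ≥ 0` and `l ≥ 1`.
The constant term of the polynomial enters only through `M`. -/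
def bilinearWeight (b c d M : ℝ) (l : ℕ) (s t : ℝ) : ℝ :=
  if M = 0 then
    s ^ (c / d - 1) * t ^ (b / d - 1) / (d ^ l * (l - 1)!) *
      ((Real.log t * Real.log s) ^ (l - 1) / (l - 1)!)
  else
    s ^ (c / d - 1) * t ^ (b / d - 1) / (d * (l - 1)!) *
      (Real.log t * Real.log s / M) ^ (((l : ℝ) - 1) / 2) *
      besselI ((l : ℝ) - 1) (2 / d * √(M * Real.log s * Real.log t))

/-- The measure `w(s, t) ds dt` on the unit square, for a nonnegative weight `w`. -/
def squareMeasure (w : ℝ → ℝ → ℝ) : Measure (ℝ × ℝ) :=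
  (volume.restrict (Ioo (0 : ℝ) 1 ×ˢ Ioo (0 : ℝ) 1)).withDensity
    fun z => ENNReal.ofReal (w z.1 z.2)

/-- The measure
`(-1)^(l-1) / (b^l (l-1)!) (log s)^(l-1) s^(a/b-1) dδ_{s^(c/b)}(t) ds` on the unit square:
the image of a measure in `s ∈ (0, 1)` with a density under `s ↦ (s, s^(c/b))`. -/
def curveMeasure (a b c : ℝ) (l : ℕ) : Measure (ℝ × ℝ) :=
  ((volume.restrict (Ioo (0 : ℝ) 1)).withDensity fun s =>
      ENNReal.ofReal ((-1) ^ (l - 1) / (b ^ l * (l - 1)!) *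
        Real.log s ^ (l - 1) * s ^ (a / b - 1))).map
    fun s => (s, s ^ (c / b))

end

/-! Positivity of p forces a > 0 and b, c, d ≥ 0. If d > 0, then p = dXY - M/d with X = x + c/d and
Y = y + b/d. For M ≥ 0 the negative binomial series of 1/p^l in M/(d²XY) has nonnegative
coefficients. Its terms are multiples of 1/(XY)^(k+l), which are moments of products of the kernels
s^(x-1)(-log s)^k/k!. Summing the kernels gives the Bessel weight (`hasSum_bilinearWeight`), and
Tonelli gives its moments. If d = 0, one kernel carried by a curve suffices.

A net with a representing measure is joint completely monotone. It is minimal because these measures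
do not charge the axes, and the measure is unique by Stone–Weierstrass.

Conversely, M < 0 is detected by one difference or derivative in the first variable and l in the
second, with l large. For nets the comparison is between rates of decay l^(-(a+b)/(c+d)) and
l^(-a/c), found from Euler's limit for Γ. For functions it is a direct computation at the origin.
Sufficiency for functions comes from a cone that M ≥ 0 makes stable under -d/dx. -/

/-! ### Mellin transform of the logarithmic kernels -/

theorem lintegral_Ioo_rpow_mul_neg_log_pow (x : ℝ) (hx : 0 < x) (k : ℕ) :
    ∫⁻ s in Ioo (0 : ℝ) 1, ENNReal.ofReal (s ^ (x - 1) * (-Real.log s) ^ k / k !) =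
      ENNReal.ofReal (1 / x ^ (k + 1)) := by
  -- The substitution s = e^(-r) produces a gamma integral.
  have himg : (fun r : ℝ => Real.exp (-r)) '' Ioi 0 = Ioo 0 1 := by
    ext s
    constructor
    · rintro ⟨r, hr, rfl⟩
      exact ⟨Real.exp_pos _, by simpa using hr⟩
    · rintro ⟨h0, h1⟩
      exact ⟨-Real.log s, by simpa using Real.log_neg h0 h1, by simp [Real.exp_log h0]⟩
  have hderiv : ∀ r ∈ Ioi (0 : ℝ),
      HasDerivWithinAt (fun r : ℝ => Real.exp (-r)) (-Real.exp (-r)) (Ioi 0) r := fun r _ => by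
    simpa using ((hasDerivAt_neg r).exp).hasDerivWithinAt
  have hinj : InjOn (fun r : ℝ => Real.exp (-r)) (Ioi 0) := fun r _ r' _ h => by
    simpa using h
  rw [← himg, lintegral_image_eq_lintegral_abs_deriv_mul measurableSet_Ioi hderiv hinj]
  have hG := Real.integral_rpow_mul_exp_neg_mul_Ioi (a := (k : ℝ) + 1) (r := x) (by positivity) hx
  have hne : (1 / x) ^ ((k : ℝ) + 1) * Real.Gamma (k + 1) ≠ 0 := by
    have := Real.Gamma_pos_of_pos (show (0 : ℝ) < k + 1 by positivity)
    positivity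
  have hint : Integrable (fun r : ℝ => r ^ ((k : ℝ) + 1 - 1) * Real.exp (-(x * r)))
      (volume.restrict (Ioi 0)) := by
    -- A non-integrable function would have integral 0, but the gamma value is positive.
    by_contra h
    rw [integral_undef h] at hG
    exact hne hG.symm
  have hnn : 0 ≤ᵐ[volume.restrict (Ioi (0 : ℝ))]
      fun r : ℝ => r ^ ((k : ℝ) + 1 - 1) * Real.exp (-(x * r)) / k ! := by
    filter_upwards [self_mem_ae_restrict measurableSet_Ioi] with r hr
    have : (0 : ℝ) < r := hr
    simp only [Pi.zero_apply]
    positivity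
  calc _ = ∫⁻ r in Ioi (0 : ℝ),
        ENNReal.ofReal (r ^ ((k : ℝ) + 1 - 1) * Real.exp (-(x * r)) / k !) := by
        refine setLIntegral_congr_fun measurableSet_Ioi fun r hr => ?_
        rw [← ENNReal.ofReal_mul (abs_nonneg _), abs_neg, abs_of_pos (Real.exp_pos _),
          Real.log_exp, ← Real.exp_mul, add_sub_cancel_right, Real.rpow_natCast, neg_neg,
          mul_div_assoc, ← mul_assoc, ← Real.exp_add]
        congr 1
        rw [show -r + -r * (x - 1) = -(x * r) by ring]
        ring
    _ = _ := by
        rw [← ofReal_integral_eq_lintegral_ofReal (hint.div_const _) hnn, integral_div, hG,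
          Real.Gamma_nat_eq_factorial, mul_div_assoc, div_self (by positivity), mul_one]
        congr 1
        rw [← Nat.cast_add_one, Real.rpow_natCast, one_div_pow]

/-! ### Representing measures: uniqueness and differences -/

/-- The monomials span an algebra that separates the points of the compact square, so their
integrals determine a finite measure. -/
theorem measure_ext_of_forall_moment_eq {μ ν : Measure (ℝ × ℝ)} [IsFiniteMeasure μ]
    [IsFiniteMeasure ν] (hμ : μ (Icc 0 1 ×ˢ Icc 0 1)ᶜ = 0) (hν : ν (Icc 0 1 ×ˢ Icc 0 1)ᶜ = 0)
    (h : ∀ m n : ℕ, ∫ z, z.1 ^ m * z.2 ^ n ∂μ = ∫ z, z.1 ^ m * z.2 ^ n ∂ν) : μ = ν := by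
  set K : Set (ℝ × ℝ) := Icc 0 1 ×ˢ Icc 0 1 with hK
  have hKm : MeasurableSet K := measurableSet_Icc.prod measurableSet_Icc
  have hKc : CompactSpace K := isCompact_iff_compactSpace.1 (isCompact_Icc.prod isCompact_Icc)
  have hrestr : ∀ ρ : Measure (ℝ × ℝ), ρ Kᶜ = 0 → ρ.restrict K = ρ := fun ρ hρ =>
    Measure.restrict_eq_self_of_ae_mem (mem_ae_iff.2 hρ)
  have hfin : ∀ ρ : Measure (ℝ × ℝ), IsFiniteMeasure ρ →
      IsFiniteMeasure (ρ.comap ((↑) : K → ℝ × ℝ)) := fun ρ _ =>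
    ⟨by rw [comap_subtype_coe_apply hKm]; exact measure_lt_top _ _⟩
  have := hfin μ inferInstance
  have := hfin ν inferInstance
  suffices hc : μ.comap ((↑) : K → ℝ × ℝ) = ν.comap ((↑) : K → ℝ × ℝ) by
    rw [← hrestr μ hμ, ← hrestr ν hν, ← map_comap_subtype_coe hKm, hc, map_comap_subtype_coe hKm]
  let X : BoundedContinuousFunction K ℝ :=
    BoundedContinuousFunction.mkOfCompact ⟨fun z => (z : ℝ × ℝ).1, by fun_prop⟩
  let Y : BoundedContinuousFunction K ℝ :=
    BoundedContinuousFunction.mkOfCompact ⟨fun z => (z : ℝ × ℝ).2, by fun_prop⟩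
  let A : StarSubalgebra ℝ (BoundedContinuousFunction K ℝ) :=
    { Algebra.adjoin ℝ {X, Y} with
      star_mem' := fun {f} hf => by
        have : star f = f := by ext; simp
        rwa [this] }
  refine ext_of_forall_mem_subalgebra_integral_eq_of_pseudoEMetric_complete_countable
    (𝕜 := ℝ) (A := A) ?_ ?_
  · intro z w hzw
    have hmem : ∀ f ∈ ({X, Y} : Set (BoundedContinuousFunction K ℝ)), f ∈ A := fun f hf =>
      Algebra.subset_adjoin hf
    by_cases h1 : (z : ℝ × ℝ).1 = (w : ℝ × ℝ).1
    · refine ⟨_, ⟨_, ⟨Y, hmem Y (by simp), rfl⟩, rfl⟩, fun h2 => hzw ?_⟩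
      exact Subtype.ext (Prod.ext h1 h2)
    · exact ⟨_, ⟨_, ⟨X, hmem X (by simp), rfl⟩, rfl⟩, h1⟩
  · intro g hg
    have hg' : g ∈ Submodule.span ℝ (Submonoid.closure {X, Y} :
        Set (BoundedContinuousFunction K ℝ)) := by
      rw [← Algebra.adjoin_eq_span]
      exact hg
    clear hg
    induction hg' using Submodule.span_induction with
    | mem f hf =>
      obtain ⟨m, n, rfl⟩ := (Submonoid.mem_closure_pair _ _ _).1 hf
      have key : ∀ ρ : Measure (ℝ × ℝ), ρ Kᶜ = 0 →
          ∫ z, (X ^ m * Y ^ n) z ∂(ρ.comap ((↑) : K → ℝ × ℝ)) = ∫ z, z.1 ^ m * z.2 ^ n ∂ρ := by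
        intro ρ hρ
        conv_rhs => rw [← hrestr ρ hρ]
        rw [← integral_subtype_comap hKm]
        rfl
      rw [key μ hμ, key ν hν, h]
    | zero => simp
    | add f g _ _ hf hg =>
      simp only [BoundedContinuousFunction.coe_add, Pi.add_apply]
      rw [integral_add (f.integrable _) (g.integrable _),
        integral_add (f.integrable _) (g.integrable _), hf, hg]
    | smul r f _ hf =>
      simp only [BoundedContinuousFunction.coe_smul]
      rw [integral_smul, integral_smul, hf]

theorem IsRepresentingMeasure.eq {u : ℕ × ℕ → ℝ} {μ ν : Measure (ℝ × ℝ)}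
    (hμ : IsRepresentingMeasure u μ) (hν : IsRepresentingMeasure u ν) : μ = ν := by
  have := hμ.finite
  have := hν.finite
  exact measure_ext_of_forall_moment_eq hμ.concentrated hν.concentrated fun m n => by
    rw [← hμ.moment, ← hν.moment]

/-- Moments in [0, ∞] allow Tonelli without integrability checks; the zeroth moment already gives
finiteness. -/
theorem isRepresentingMeasure_of_lintegral {u : ℕ × ℕ → ℝ} {μ : Measure (ℝ × ℝ)}
    (hμ : μ (Icc 0 1 ×ˢ Icc 0 1)ᶜ = 0) (hu : ∀ i, 0 ≤ u i)
    (h : ∀ m n : ℕ, ∫⁻ z, ENNReal.ofReal (z.1 ^ m * z.2 ^ n) ∂μ = ENNReal.ofReal (u (m, n))) :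
    IsRepresentingMeasure u μ where
  finite := ⟨by
    have := h 0 0
    simp only [pow_zero, mul_one, ENNReal.ofReal_one, lintegral_const, one_mul] at this
    rw [this]
    exact ENNReal.ofReal_lt_top⟩
  concentrated := hμ
  moment m n := by
    rw [integral_eq_lintegral_of_nonneg_ae, h, ENNReal.toReal_ofReal (hu _)]
    · filter_upwards [mem_ae_iff.2 hμ] with z hz
      exact mul_nonneg (pow_nonneg hz.1.1 _) (pow_nonneg hz.2.1 _)
    · fun_prop

theorem integrable_of_concentrated {μ : Measure (ℝ × ℝ)} [IsFiniteMeasure μ]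
    (hμ : μ (Icc 0 1 ×ˢ Icc 0 1)ᶜ = 0) {f : ℝ × ℝ → ℝ} (hf : Continuous f) : Integrable f μ := by
  rw [← Measure.restrict_eq_self_of_ae_mem (mem_ae_iff.2 hμ)]
  exact hf.continuousOn.integrableOn_compact (isCompact_Icc.prod isCompact_Icc)

/-- Each signed difference multiplies the integrand by 1 - s or 1 - t. -/
theorem IsRepresentingMeasure.fwdDiff_eq {u : ℕ × ℕ → ℝ} {μ : Measure (ℝ × ℝ)}
    (hμ : IsRepresentingMeasure u μ) (k l m n : ℕ) :
    (-1 : ℝ) ^ (k + l) * (fwdDiff (1, 0))^[k] ((fwdDiff (0, 1))^[l] u) (m, n) =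
      ∫ z, z.1 ^ m * z.2 ^ n * (1 - z.1) ^ k * (1 - z.2) ^ l ∂μ := by
  have := hμ.finite
  have hi : ∀ {f : ℝ × ℝ → ℝ}, Continuous f → Integrable f μ :=
    integrable_of_concentrated hμ.concentrated
  have h2 : ∀ l m n : ℕ, (-1 : ℝ) ^ l * (fwdDiff (0, 1))^[l] u (m, n) =
      ∫ z, z.1 ^ m * z.2 ^ n * (1 - z.2) ^ l ∂μ := by
    intro l
    induction l with
    | zero => intro m n; simpa using hμ.moment m n
    | succ l ih =>
      intro m n
      rw [Function.iterate_succ_apply', fwdDiff, pow_succ,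
        show ∀ x y : ℝ, (-1 : ℝ) ^ l * -1 * (x - y) = (-1) ^ l * y - (-1) ^ l * x by intros; ring,
        Prod.mk_add_mk, add_zero, ih, ih, ← integral_sub (hi (by fun_prop)) (hi (by fun_prop))]
      exact integral_congr_ae (.of_forall fun z => by simp only; ring)
  induction k generalizing m n with
  | zero => simpa using h2 l m n
  | succ k ih =>
    rw [Function.iterate_succ_apply', fwdDiff, add_right_comm, pow_succ,
      show ∀ x y : ℝ, (-1 : ℝ) ^ (k + l) * -1 * (x - y) = (-1) ^ (k + l) * y - (-1) ^ (k + l) * x by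
        intros; ring,
      Prod.mk_add_mk, add_zero, ih, ih, ← integral_sub (hi (by fun_prop)) (hi (by fun_prop))]
    exact integral_congr_ae (.of_forall fun z => by simp only; ring)

theorem IsRepresentingMeasure.jointCompletelyMonotoneNet {u : ℕ × ℕ → ℝ} {μ : Measure (ℝ × ℝ)}
    (hμ : IsRepresentingMeasure u μ) : JointCompletelyMonotoneNet u := by
  intro k l m n
  rw [hμ.fwdDiff_eq]
  refine integral_nonneg_of_ae ?_
  filter_upwards [mem_ae_iff.2 hμ.concentrated] with z hz
  have h1 := sub_nonneg.2 hz.1.2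
  have h2 := sub_nonneg.2 hz.2.2
  have h3 := hz.1.1
  have h4 := hz.2.1
  simp only [Pi.zero_apply]
  positivity

/-! ### Minimality -/

/-- Lowering the zeroth term by ε lowers every signed difference at 0 by exactly ε, so the limit
becomes -ε. -/
theorem not_completelyMonotoneSeq_sub_of_tendsto {v : ℕ → ℝ}
    (hv : Tendsto (fun k => (-1 : ℝ) ^ k * (fwdDiff 1)^[k] v 0) atTop (𝓝 0)) {ε : ℝ}
    (hε : 0 < ε) : ¬ CompletelyMonotoneSeq fun k => v k - if k = 0 then ε else 0 := by
  intro h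
  have hδ : ∀ k n : ℕ, (fwdDiff 1)^[k] (fun k => v k - if k = 0 then ε else 0) n =
      (fwdDiff 1)^[k] v n - if n = 0 then (-1) ^ k * ε else 0 := by
    intro k
    induction k with
    | zero => intro n; simp
    | succ k ih =>
      intro n
      rw [Function.iterate_succ_apply', Function.iterate_succ_apply', fwdDiff, fwdDiff, ih, ih]
      split_ifs <;> simp_all
      ring
  have hlim : Tendsto (fun k => (-1 : ℝ) ^ k *
      (fwdDiff 1)^[k] (fun k => v k - if k = 0 then ε else 0) 0) atTop (𝓝 (0 - ε)) := by
    refine (hv.sub_const ε).congr fun k => ?_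
    rw [hδ, if_pos rfl, mul_sub, ← mul_assoc, ← mul_pow]
    norm_num
  linarith [ge_of_tendsto' hlim fun k => h k 0]

theorem fwdDiff_iterate_fst (u : ℕ × ℕ → ℝ) (k m n : ℕ) :
    (fwdDiff 1)^[k] (fun i => u (i, n)) m = (fwdDiff (1, 0))^[k] u (m, n) := by
  induction k generalizing m with
  | zero => rfl
  | succ k ih => simp only [Function.iterate_succ_apply', fwdDiff, ih, Prod.mk_add_mk, add_zero]

theorem fwdDiff_iterate_snd (u : ℕ × ℕ → ℝ) (k m n : ℕ) :
    (fwdDiff 1)^[k] (fun i => u (m, i)) n = (fwdDiff (0, 1))^[k] u (m, n) := by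
  induction k generalizing n with
  | zero => rfl
  | succ k ih => simp only [Function.iterate_succ_apply', fwdDiff, ih, Prod.mk_add_mk, add_zero]

/-- Off the axes (1 - s)^k and (1 - t)^k tend to 0, dominated by 1; their integrals are the signed
differences at the origin. -/
theorem IsRepresentingMeasure.minimalJointCompletelyMonotoneNet {u : ℕ × ℕ → ℝ}
    {μ : Measure (ℝ × ℝ)} (hμ : IsRepresentingMeasure u μ)
    (hpos : ∀ᵐ z ∂μ, 0 < z.1 ∧ 0 < z.2) : MinimalJointCompletelyMonotoneNet u := by
  have := hμ.finite
  have hlim : ∀ f : ℝ × ℝ → ℝ, Continuous f → (∀ᵐ z ∂μ, 0 < f z ∧ f z ≤ 1) →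
      Tendsto (fun k : ℕ => ∫ z, (1 - f z) ^ k ∂μ) atTop (𝓝 0) := by
    intro f hf h
    rw [← integral_zero (ℝ × ℝ) ℝ (μ := μ)]
    refine tendsto_integral_of_dominated_convergence (fun _ => 1) (fun k => by fun_prop)
      (integrable_const 1) (fun k => ?_) ?_
    · filter_upwards [h] with z hz
      rw [Real.norm_eq_abs, abs_pow]
      exact pow_le_one₀ (abs_nonneg _) (abs_le.2 ⟨by linarith, by linarith⟩)
    · filter_upwards [h] with z hz
      exact tendsto_pow_atTop_nhds_zero_of_lt_one (by linarith) (by linarith)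
  refine ⟨hμ.jointCompletelyMonotoneNet, fun ε hε =>
    ⟨not_completelyMonotoneSeq_sub_of_tendsto ?_ hε,
      not_completelyMonotoneSeq_sub_of_tendsto ?_ hε⟩⟩
  · refine (hlim Prod.fst continuous_fst ?_).congr fun k => ?_
    · filter_upwards [hpos, mem_ae_iff.2 hμ.concentrated] with z hz hz'
      exact ⟨hz.1, hz'.1.2⟩
    · simpa [fwdDiff_iterate_fst] using (hμ.fwdDiff_eq k 0 0 0).symm
  · refine (hlim Prod.snd continuous_snd ?_).congr fun k => ?_
    · filter_upwards [hpos, mem_ae_iff.2 hμ.concentrated] with z hz hz'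
      exact ⟨hz.2, hz'.2.2⟩
    · simpa [fwdDiff_iterate_snd] using (hμ.fwdDiff_eq 0 k 0 0).symm

/-! ### Logarithmic kernels and the Bessel series -/

noncomputable section

/-- The function `s ↦ s^(x-1) (-log s)^k / k!`, whose Mellin transform on `(0, 1)` is
`1 / x^(k+1)`. -/
def logKernel (x : ℝ) (k : ℕ) (s : ℝ) : ℝ := s ^ (x - 1) * (-Real.log s) ^ k / k !

/-- The power series `∑ₖ y^k / (k! (q + k)!)` of the modified Bessel function of order `q`. -/
def besselSeries (q : ℕ) (y : ℝ) : ℝ := ∑' k : ℕ, y ^ k / (k ! * (q + k)!)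

end

theorem measurable_logKernel (x : ℝ) (k : ℕ) : Measurable (logKernel x k) := by
  unfold logKernel
  fun_prop

theorem logKernel_nonneg {x : ℝ} {k : ℕ} {s : ℝ} (hs : s ∈ Ioo (0 : ℝ) 1) :
    0 ≤ logKernel x k s := by
  have h0 := hs.1
  have := neg_nonneg.2 (Real.log_neg hs.1 hs.2).le
  unfold logKernel
  positivity

theorem logKernel_mul_rpow (x e : ℝ) (k : ℕ) {s : ℝ} (hs : 0 < s) :
    logKernel x k s * s ^ e = logKernel (x + e) k s := by
  rw [logKernel, logKernel, show x + e - 1 = x - 1 + e by ring, Real.rpow_add hs]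
  ring

theorem logKernel_mul_pow (x : ℝ) (k m : ℕ) {s : ℝ} (hs : 0 < s) :
    logKernel x k s * s ^ m = logKernel (x + m) k s := by
  rw [← Real.rpow_natCast, logKernel_mul_rpow x m k hs]

theorem lintegral_logKernel {x : ℝ} (hx : 0 < x) (k : ℕ) :
    ∫⁻ s in Ioo (0 : ℝ) 1, ENNReal.ofReal (logKernel x k s) =
      ENNReal.ofReal (1 / x ^ (k + 1)) :=
  lintegral_Ioo_rpow_mul_neg_log_pow x hx k

theorem norm_besselSeries_term_le (q k : ℕ) (y : ℝ) :
    ‖y ^ k / (k ! * (q + k)!)‖ ≤ |y| ^ k / k ! := by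
  rw [norm_div, norm_pow, Real.norm_eq_abs, norm_mul, Real.norm_natCast, Real.norm_natCast]
  refine div_le_div_of_nonneg_left (by positivity) (by positivity) ?_
  exact le_mul_of_one_le_right (by positivity) (by exact_mod_cast Nat.factorial_pos _)

theorem hasSum_besselSeries (q : ℕ) (y : ℝ) :
    HasSum (fun k : ℕ => y ^ k / (k ! * (q + k)!)) (besselSeries q y) :=
  (Summable.of_norm_bounded (Real.summable_pow_div_factorial |y|)
    (norm_besselSeries_term_le q · y)).hasSum

theorem tendsto_besselSeries_zero (q : ℕ) :
    Tendsto (besselSeries q) (𝓝 0) (𝓝 (besselSeries q 0)) := by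
  refine tendsto_tsum_of_dominated_convergence (Real.summable_pow_div_factorial 1)
    (fun k => ((continuous_pow k).div_const _).tendsto 0) ?_
  filter_upwards [Metric.closedBall_mem_nhds (0 : ℝ) one_pos] with y hy k
  refine (norm_besselSeries_term_le q k y).trans ?_
  have : |y| ≤ 1 := by simpa using hy
  gcongr

theorem besselSeries_zero (q : ℕ) : besselSeries q 0 = 1 / q ! := by
  rw [besselSeries, tsum_eq_single 0 fun k hk => by simp [hk]]
  simp

theorem besselI_natCast (q : ℕ) (z : ℝ) :
    besselI q z = (z / 2) ^ q * besselSeries q (z ^ 2 / 4) := by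
  rw [besselI, besselSeries, Real.rpow_natCast]
  congr 1
  refine tsum_congr fun k => ?_
  rw [← Nat.cast_add, Real.Gamma_nat_eq_factorial]

/-- One expression covers M = 0 and M > 0: the square roots cancel in the prefactor, and the series
depends on the Bessel argument only through its square. The limit M → 0 then follows from continuity
of the series at 0. -/
theorem bilinearWeight_eq_besselSeries {b c d M : ℝ} (hM : 0 ≤ M) (q : ℕ) {s t : ℝ}
    (hs : s ∈ Ioo (0 : ℝ) 1) (ht : t ∈ Ioo (0 : ℝ) 1) :
    bilinearWeight b c d M (q + 1) s t =
      s ^ (c / d - 1) * t ^ (b / d - 1) * (Real.log s * Real.log t) ^ q / (d ^ (q + 1) * q !) *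
        besselSeries q (M * (Real.log s * Real.log t) / d ^ 2) := by
  have hL : 0 < Real.log s * Real.log t :=
    mul_pos_of_neg_of_neg (Real.log_neg hs.1 hs.2) (Real.log_neg ht.1 ht.2)
  rcases hM.eq_or_lt with rfl | hM
  · rw [bilinearWeight, if_pos rfl, zero_mul, zero_div, besselSeries_zero, Nat.add_sub_cancel,
      mul_comm (Real.log t)]
    ring
  · rw [bilinearWeight, if_neg hM.ne', Nat.add_sub_cancel, Nat.cast_add_one, add_sub_cancel_right,
      besselI_natCast, mul_comm (Real.log t), mul_assoc M]
    set L := Real.log s * Real.log t with hLdef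
    have h1 : (L / M) ^ ((q : ℝ) / 2) = √(L / M) ^ q := by
      rw [Real.sqrt_eq_rpow, ← Real.rpow_natCast, ← Real.rpow_mul (by positivity)]
      ring_nf
    have h2 : √(L / M) * (2 / d * √(M * L) / 2) = L / d := by
      rw [show √(L / M) * (2 / d * √(M * L) / 2) = √(L / M) * √(M * L) / d by ring,
        ← Real.sqrt_mul (by positivity), show L / M * (M * L) = L ^ 2 by field_simp,
        Real.sqrt_sq hL.le]
    have h3 : (2 / d * √(M * L)) ^ 2 / 4 = M * L / d ^ 2 := by
      rw [mul_pow, Real.sq_sqrt (by positivity)]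
      ring
    rw [h1, h3, mul_assoc, ← mul_assoc (√(L / M) ^ q), ← mul_pow, h2, div_pow, pow_succ]
    ring

theorem hasSum_bilinearWeight {b c d M : ℝ} (hd : 0 < d) (hM : 0 ≤ M) (q : ℕ) {s t : ℝ}
    (hs : s ∈ Ioo (0 : ℝ) 1) (ht : t ∈ Ioo (0 : ℝ) 1) :
    HasSum (fun k => (k + q).choose q * M ^ k / d ^ (q + 1 + 2 * k) *
        (logKernel (c / d) (k + q) s * logKernel (b / d) (k + q) t))
      (bilinearWeight b c d M (q + 1) s t) := by
  rw [bilinearWeight_eq_besselSeries hM q hs ht]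
  refine ((hasSum_besselSeries q _).mul_left _).congr_fun fun k => ?_
  -- The two kernels contribute (k+q)!² to the denominator; the binomial coefficient reduces it to
  -- q! k! (k+q)!.
  have hch : ((k + q).choose q : ℝ) * (k ! * q !) = (k + q)! := by
    have := Nat.add_choose_mul_factorial_mul_factorial k q
    rw [← mul_assoc]
    exact_mod_cast this
  have hch' : ((k + q).choose q : ℝ) = (k + q)! / (k ! * q !) := by
    rw [← hch]
    field_simp
  rw [hch', logKernel, logKernel, add_comm q k]
  have : (Real.log s * Real.log t) ^ q * (M * (Real.log s * Real.log t) / d ^ 2) ^ k =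
      M ^ k * (-Real.log s) ^ (k + q) * (-Real.log t) ^ (k + q) / d ^ (2 * k) := by
    rw [mul_assoc, ← mul_pow, neg_mul_neg, div_pow, mul_pow, pow_add, ← pow_mul]
    ring
  calc _ = s ^ (c / d - 1) * t ^ (b / d - 1) * (M ^ k * (-Real.log s) ^ (k + q) *
        (-Real.log t) ^ (k + q) / d ^ (2 * k)) / (d ^ (q + 1) * q ! * (k ! * (k + q)!)) := by
        rw [pow_add d]
        field_simp
    _ = _ := by
        rw [← this]
        ring

theorem tendsto_bilinearWeight {b c d : ℝ} (q : ℕ) {s t : ℝ}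
    (hs : s ∈ Ioo (0 : ℝ) 1) (ht : t ∈ Ioo (0 : ℝ) 1) :
    Tendsto (fun M => bilinearWeight b c d M (q + 1) s t) (𝓝[>] 0)
      (𝓝 (bilinearWeight b c d 0 (q + 1) s t)) := by
  rw [bilinearWeight_eq_besselSeries le_rfl q hs ht]
  have hlin : Tendsto (fun M : ℝ => M * (Real.log s * Real.log t) / d ^ 2) (𝓝[>] 0) (𝓝 0) := by
    have h : Continuous fun M : ℝ => M * (Real.log s * Real.log t) / d ^ 2 := by fun_prop
    simpa using (h.tendsto 0).mono_left nhdsWithin_le_nhds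
  rw [zero_mul, zero_div]
  refine (((tendsto_besselSeries_zero q).comp hlin).const_mul _).congr' ?_
  filter_upwards [self_mem_nhdsWithin] with M hM
  exact (bilinearWeight_eq_besselSeries (le_of_lt hM) q hs ht).symm

/-! ### The representing measure for d > 0 -/

theorem hasSum_inv_bidegOnePoly_pow {d M X Y : ℝ} (hd : 0 < d) (hM : 0 ≤ M) (hX : 0 < X)
    (hY : 0 < Y) (hp : 0 < d * X * Y - M / d) (q : ℕ) :
    HasSum (fun k => (k + q).choose q * M ^ k / d ^ (q + 1 + 2 * k) *
        (1 / X ^ (k + q + 1) * (1 / Y ^ (k + q + 1)))) (1 / (d * X * Y - M / d) ^ (q + 1)) := by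
  -- Convergence of the series is precisely the positivity of dXY - M/d.
  have hr : ‖M / (d ^ 2 * X * Y)‖ < 1 := by
    rw [Real.norm_of_nonneg (by positivity), div_lt_one (by positivity)]
    have := mul_pos hp hd
    field_simp at this
    nlinarith
  convert! (hasSum_choose_mul_geometric_of_norm_lt_one q hr).mul_left (1 / (d * X * Y) ^ (q + 1))
    using 1
  · ext k
    rw [div_pow, mul_pow, mul_pow, mul_pow, mul_pow, ← pow_mul]
    simp only [pow_add, pow_one]
    field_simp
  · rw [div_mul_div_comm, one_mul, ← mul_pow]
    congr 2
    field_simp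

theorem measurable_ofReal_logKernel_mul (x y : ℝ) (k : ℕ) :
    Measurable fun z : ℝ × ℝ =>
      ENNReal.ofReal (logKernel x k z.1) * ENNReal.ofReal (logKernel y k z.2) :=
  ((measurable_logKernel x k).comp measurable_fst).ennreal_ofReal.mul
    ((measurable_logKernel y k).comp measurable_snd).ennreal_ofReal

theorem isRepresentingMeasure_squareMeasure {a b c d : ℝ} (hd : 0 < d) (hb : 0 < b) (hc : 0 < c)
    (hp : ∀ x y : ℝ, 0 ≤ x → 0 ≤ y → 0 < bidegOnePoly a b c d x y) (hM : 0 ≤ b * c - a * d)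
    (q : ℕ) :
    IsRepresentingMeasure (fun i => 1 / bidegOnePoly a b c d i.1 i.2 ^ (q + 1))
      (squareMeasure (bilinearWeight b c d (b * c - a * d) (q + 1))) := by
  set M := b * c - a * d with hMdef
  let R : Measure ℝ := volume.restrict (Ioo 0 1)
  let coef : ℕ → ℝ := fun k => (k + q).choose q * M ^ k / d ^ (q + 1 + 2 * k)
  have hcoef : ∀ k, 0 ≤ coef k := fun k => by positivity
  let T : ℕ → ℝ × ℝ → ENNReal := fun k z => ENNReal.ofReal (coef k) *
    (ENNReal.ofReal (logKernel (c / d) (k + q) z.1) *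
      ENNReal.ofReal (logKernel (b / d) (k + q) z.2))
  have hT : ∀ k, Measurable (T k) := fun k =>
    (measurable_ofReal_logKernel_mul _ _ _).const_mul _
  have hRR : (volume : Measure (ℝ × ℝ)).restrict (Ioo 0 1 ×ˢ Ioo 0 1) = R.prod R := by
    rw [Measure.volume_eq_prod, Measure.prod_restrict]
  have hsqm : MeasurableSet (Ioo (0 : ℝ) 1 ×ˢ Ioo (0 : ℝ) 1) :=
    measurableSet_Ioo.prod measurableSet_Ioo
  have hmem : ∀ᵐ z ∂(R.prod R), z ∈ Ioo (0 : ℝ) 1 ×ˢ Ioo (0 : ℝ) 1 := by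
    rw [← hRR]
    exact self_mem_ae_restrict hsqm
  have hsq : squareMeasure (bilinearWeight b c d M (q + 1)) =
      (R.prod R).withDensity fun z => ∑' k, T k z := by
    rw [squareMeasure, hRR]
    refine withDensity_congr_ae ?_
    filter_upwards [hmem] with z hz
    have h := hasSum_bilinearWeight (b := b) (c := c) hd hM q hz.1 hz.2
    rw [← h.tsum_eq, ENNReal.ofReal_tsum_of_nonneg (fun k => mul_nonneg (hcoef k)
      (mul_nonneg (logKernel_nonneg hz.1) (logKernel_nonneg hz.2))) h.summable]
    refine tsum_congr fun k => ?_
    rw [ENNReal.ofReal_mul (hcoef k), ENNReal.ofReal_mul (logKernel_nonneg hz.1)]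
  refine isRepresentingMeasure_of_lintegral ?_ ?_ fun m n => ?_
  · rw [hsq]
    refine withDensity_absolutelyContinuous _ _ ?_
    change ∀ᵐ z ∂(R.prod R), z ∈ Icc (0 : ℝ) 1 ×ˢ Icc (0 : ℝ) 1
    filter_upwards [hmem] with z hz
    exact ⟨Ioo_subset_Icc_self hz.1, Ioo_subset_Icc_self hz.2⟩
  · intro i
    have := hp i.1 i.2 i.1.cast_nonneg i.2.cast_nonneg
    positivity
  have hX : 0 < c / d + m := by positivity
  have hY : 0 < b / d + n := by positivity
  have hpXY : bidegOnePoly a b c d m n = d * (c / d + m) * (b / d + n) - M / d := by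
    rw [bidegOnePoly, hMdef]
    field_simp
    ring
  have hpmn := hp m n m.cast_nonneg n.cast_nonneg
  simp only
  rw [hpXY] at hpmn ⊢
  have hsum := hasSum_inv_bidegOnePoly_pow hd hM hX hY hpmn q
  rw [hsq, lintegral_withDensity_eq_lintegral_mul _ (Measurable.tsum hT) (by fun_prop),
    ← hsum.tsum_eq, ENNReal.ofReal_tsum_of_nonneg (fun k => by positivity) hsum.summable]
  calc _ = ∫⁻ z, ∑' k, ENNReal.ofReal (coef k) *
          (ENNReal.ofReal (logKernel (c / d + m) (k + q) z.1) *
            ENNReal.ofReal (logKernel (b / d + n) (k + q) z.2)) ∂(R.prod R) := by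
        refine lintegral_congr_ae ?_
        filter_upwards [hmem] with z hz
        rw [Pi.mul_apply, ← ENNReal.tsum_mul_right]
        refine tsum_congr fun k => ?_
        rw [← logKernel_mul_pow _ _ m hz.1.1, ← logKernel_mul_pow _ _ n hz.2.1,
          ENNReal.ofReal_mul (logKernel_nonneg hz.1), ENNReal.ofReal_mul (logKernel_nonneg hz.2),
          ENNReal.ofReal_mul (pow_nonneg hz.1.1.le _)]
        ring
    _ = ∑' k, ENNReal.ofReal (coef k) *
          ((∫⁻ s, ENNReal.ofReal (logKernel (c / d + m) (k + q) s) ∂ R) *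
            ∫⁻ t, ENNReal.ofReal (logKernel (b / d + n) (k + q) t) ∂ R) := by
        rw [lintegral_tsum fun k =>
          ((measurable_ofReal_logKernel_mul _ _ (k + q)).const_mul _).aemeasurable]
        refine tsum_congr fun k => ?_
        rw [lintegral_const_mul _ (measurable_ofReal_logKernel_mul _ _ _),
          lintegral_prod_mul (measurable_logKernel _ _).ennreal_ofReal.aemeasurable
            (measurable_logKernel _ _).ennreal_ofReal.aemeasurable]
    _ = _ := by
        refine tsum_congr fun k => ?_
        rw [lintegral_logKernel hX, lintegral_logKernel hY, ← ENNReal.ofReal_mul (by positivity),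
          ← ENNReal.ofReal_mul (hcoef k)]

theorem ae_pos_squareMeasure (w : ℝ → ℝ → ℝ) : ∀ᵐ z ∂squareMeasure w, 0 < z.1 ∧ 0 < z.2 := by
  refine (withDensity_absolutelyContinuous _ _).ae_le ?_
  filter_upwards [self_mem_ae_restrict (measurableSet_Ioo.prod measurableSet_Ioo)] with z hz
  exact ⟨hz.1.1, hz.2.1⟩

/-! ### Measures on power curves, for d = 0 -/

noncomputable section

/-- The image of the measure `κ s^(x-1) (-log s)^k / k! ds` on `(0, 1)` under
`s ↦ (s^e, s^f)`. -/
def powerCurveMeasure (κ x : ℝ) (k : ℕ) (e f : ℝ) : Measure (ℝ × ℝ) :=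
  ((volume.restrict (Ioo (0 : ℝ) 1)).withDensity fun s =>
    ENNReal.ofReal (κ * logKernel x k s)).map fun s => (s ^ e, s ^ f)

end

theorem ae_powerCurveMeasure {κ x : ℝ} {k : ℕ} {e f : ℝ} {P : ℝ × ℝ → Prop}
    (hP : MeasurableSet {z | P z}) (h : ∀ s ∈ Ioo (0 : ℝ) 1, P (s ^ e, s ^ f)) :
    ∀ᵐ z ∂powerCurveMeasure κ x k e f, P z := by
  rw [powerCurveMeasure, ae_map_iff (by fun_prop) hP]
  refine (withDensity_absolutelyContinuous _ _).ae_le ?_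
  filter_upwards [self_mem_ae_restrict measurableSet_Ioo] with s hs
  exact h s hs

theorem ae_pos_powerCurveMeasure (κ x : ℝ) (k : ℕ) (e f : ℝ) :
    ∀ᵐ z ∂powerCurveMeasure κ x k e f, 0 < z.1 ∧ 0 < z.2 :=
  ae_powerCurveMeasure ((measurableSet_lt measurable_const measurable_fst).inter
    (measurableSet_lt measurable_const measurable_snd)) fun _ hs =>
      ⟨Real.rpow_pos_of_pos hs.1 _, Real.rpow_pos_of_pos hs.1 _⟩

theorem isRepresentingMeasure_powerCurveMeasure {κ x e f : ℝ} (hκ : 0 ≤ κ) (hx : 0 < x)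
    (he : 0 ≤ e) (hf : 0 ≤ f) (k : ℕ) :
    IsRepresentingMeasure (fun i => κ / (x + e * i.1 + f * i.2) ^ (k + 1))
      (powerCurveMeasure κ x k e f) := by
  refine isRepresentingMeasure_of_lintegral ?_ (fun i => by positivity) fun m n => ?_
  · refine mem_ae_iff.1 (ae_powerCurveMeasure (P := (· ∈ Icc 0 1 ×ˢ Icc 0 1))
      (measurableSet_Icc.prod measurableSet_Icc) fun s hs => ?_)
    exact ⟨⟨Real.rpow_nonneg hs.1.le _, Real.rpow_le_one hs.1.le hs.2.le he⟩,
      ⟨Real.rpow_nonneg hs.1.le _, Real.rpow_le_one hs.1.le hs.2.le hf⟩⟩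
  have hg : Measurable fun z : ℝ × ℝ => ENNReal.ofReal (z.1 ^ m * z.2 ^ n) := by fun_prop
  have hκm : Measurable fun s => ENNReal.ofReal (κ * logKernel x k s) :=
    ((measurable_logKernel _ _).const_mul _).ennreal_ofReal
  have hφ : Measurable fun s : ℝ => (s ^ e, s ^ f) := by fun_prop
  rw [powerCurveMeasure, lintegral_map hg hφ,
    lintegral_withDensity_eq_lintegral_mul _ hκm (by fun_prop)]
  calc _ = ∫⁻ s in Ioo (0 : ℝ) 1, ENNReal.ofReal κ *
        ENNReal.ofReal (logKernel (x + e * m + f * n) k s) := by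
        -- On the curve the monomial is s^(em + fn), which only shifts the exponent of the kernel.
        refine setLIntegral_congr_fun measurableSet_Ioo fun s hs => ?_
        have h0 : (0 : ℝ) < s := hs.1
        rw [Pi.mul_apply, ← ENNReal.ofReal_mul (mul_nonneg hκ (logKernel_nonneg hs)),
          ← ENNReal.ofReal_mul hκ, ← logKernel_mul_rpow _ _ _ h0, ← logKernel_mul_rpow _ _ _ h0,
          Real.rpow_mul_natCast h0.le, Real.rpow_mul_natCast h0.le]
        congr 1
        ring
    _ = _ := by
        rw [lintegral_const_mul _ (measurable_logKernel _ _).ennreal_ofReal,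
          lintegral_logKernel (by positivity), ← ENNReal.ofReal_mul hκ, mul_one_div]

theorem curveMeasure_eq_powerCurveMeasure (a b c : ℝ) (q : ℕ) :
    curveMeasure a b c (q + 1) = powerCurveMeasure (1 / b ^ (q + 1)) (a / b) q 1 (c / b) := by
  rw [curveMeasure, powerCurveMeasure]
  simp only [Real.rpow_one]
  congr 2
  ext s
  rw [logKernel, Nat.add_sub_cancel, neg_pow]
  congr 1
  ring

theorem isRepresentingMeasure_curveMeasure {a b c : ℝ} (ha : 0 < a) (hb : 0 < b) (hc : 0 ≤ c)
    (q : ℕ) :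
    IsRepresentingMeasure (fun i => 1 / bidegOnePoly a b c 0 i.1 i.2 ^ (q + 1))
      (curveMeasure a b c (q + 1)) := by
  rw [curveMeasure_eq_powerCurveMeasure]
  convert! isRepresentingMeasure_powerCurveMeasure (κ := 1 / b ^ (q + 1)) (x := a / b) (e := 1)
    (f := c / b) (by positivity) (by positivity) zero_le_one (by positivity) q using 2 with i
  rw [div_div, ← mul_pow, bidegOnePoly]
  congr 2
  field_simp
  ring

/-! ### Necessity of M ≥ 0 for nets -/

theorem fwdDiff_iterate_inv_linear {A B : ℝ} (hA : 0 < A) (hB : 0 ≤ B) (l n : ℕ) :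
    (-1 : ℝ) ^ l * (fwdDiff 1)^[l] (fun n : ℕ => 1 / (A + B * n)) n =
      l ! * B ^ l / ∏ j ∈ Finset.range (l + 1), (A + B * (n + j)) := by
  have hpos : ∀ n j : ℕ, 0 < A + B * (n + j) := fun n j => by positivity
  induction l generalizing n with
  | zero => simp
  | succ l ih =>
    rw [Function.iterate_succ_apply', fwdDiff, pow_succ,
      show ∀ x y : ℝ, (-1 : ℝ) ^ l * -1 * (x - y) = (-1) ^ l * y - (-1) ^ l * x by intros; ring,
      ih, ih]
    have h1 : ∏ j ∈ Finset.range (l + 1 + 1), (A + B * ((n : ℝ) + j)) =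
        (∏ j ∈ Finset.range (l + 1), (A + B * ((n : ℝ) + j))) * (A + B * (n + (l + 1 : ℕ))) :=
      Finset.prod_range_succ _ _
    have h2 : ∏ j ∈ Finset.range (l + 1 + 1), (A + B * ((n : ℝ) + j)) =
        (∏ j ∈ Finset.range (l + 1), (A + B * (((n + 1 : ℕ) : ℝ) + j))) * (A + B * n) := by
      rw [Finset.prod_range_succ']
      simp only [Nat.cast_add, Nat.cast_one, Nat.cast_zero, add_zero]
      congr 1
      refine Finset.prod_congr rfl fun j _ => ?_
      ring
    have hP : 0 < ∏ j ∈ Finset.range (l + 1), (A + B * ((n : ℝ) + j)) :=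
      Finset.prod_pos fun j _ => hpos n j
    have hQ : 0 < ∏ j ∈ Finset.range (l + 1), (A + B * (((n + 1 : ℕ) : ℝ) + j)) :=
      Finset.prod_pos fun j _ => hpos (n + 1) j
    have hn : 0 < A + B * n := by positivity
    have hl := hpos n (l + 1)
    -- Peeling the longer product at either end gives the relation between the products based at n
    -- and n + 1.
    rw [h1] at h2
    rw [h1, div_sub_div _ _ hP.ne' hQ.ne', div_eq_div_iff (by positivity) (by positivity),
      Nat.factorial_succ]
    push_cast at h2 hQ hl ⊢
    generalize ∏ j ∈ Finset.range (l + 1), (A + B * ((n : ℝ) + j)) = P at *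
    generalize ∏ j ∈ Finset.range (l + 1), (A + B * ((n : ℝ) + 1 + j)) = Q at *
    linear_combination -((l ! : ℝ) * B ^ l * P) * h2

/-- With Euler's limit this shows that the l-th signed difference of 1/(A + Bn) at 0 is asymptotic
to Γ(A/B)/(B l^(A/B)). -/
theorem prod_linear_eq_gammaSeq {A B : ℝ} (hA : 0 < A) (hB : 0 < B) {l : ℕ} (hl : 0 < l) :
    l ! * B ^ l / ∏ j ∈ Finset.range (l + 1), (A + B * j) =
      Real.GammaSeq (A / B) l / (B * (l : ℝ) ^ (A / B)) := by
  have hprod : ∏ j ∈ Finset.range (l + 1), (A + B * j) =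
      B ^ (l + 1) * ∏ j ∈ Finset.range (l + 1), (A / B + j) := by
    rw [← Finset.card_range (l + 1), ← Finset.prod_const, Finset.card_range,
      ← Finset.prod_mul_distrib]
    refine Finset.prod_congr rfl fun j _ => ?_
    field_simp
  have hP : 0 < ∏ j ∈ Finset.range (l + 1), (A / B + (j : ℝ)) :=
    Finset.prod_pos fun j _ => by positivity
  have hl' : (0 : ℝ) < (l : ℝ) ^ (A / B) := by positivity
  rw [hprod, Real.GammaSeq, pow_succ B]
  field_simp

theorem JointCompletelyMonotoneNet.det_nonneg {a b c d : ℝ} (ha : 0 < a) (hb : 0 ≤ b) (hc : 0 ≤ c)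
    (h : JointCompletelyMonotoneNet fun i => 1 / bidegOnePoly a b c d i.1 i.2) :
    0 ≤ b * c - a * d := by
  by_contra! hM
  have hd' : 0 < d := by
    by_contra! hd0
    nlinarith [mul_nonneg hb hc]
  have hrow : ∀ l m : ℕ, (-1 : ℝ) ^ l *
      (fwdDiff (0, 1))^[l] (fun i : ℕ × ℕ => 1 / bidegOnePoly a b c d i.1 i.2) (m, 0) =
      l ! * (c + d * m) ^ l / ∏ j ∈ Finset.range (l + 1), (a + b * m + (c + d * m) * j) := by
    intro l m
    rw [← fwdDiff_iterate_snd (fun i : ℕ × ℕ => 1 / bidegOnePoly a b c d i.1 i.2)]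
    have := fwdDiff_iterate_inv_linear (A := a + b * m) (B := c + d * m) (by positivity)
      (by positivity) l 0
    simp only [Nat.cast_zero, zero_add] at this
    rw [← this]
    refine congrArg (fun f : ℕ → ℝ => (-1 : ℝ) ^ l * (fwdDiff 1)^[l] f 0) (funext fun n => ?_)
    simp only [bidegOnePoly]
    congr 1
    ring
  -- One difference in the first index compares the columns m = 1 and m = 0.
  have hle : ∀ l : ℕ, l ! * (c + d) ^ l / ∏ j ∈ Finset.range (l + 1), (a + b + (c + d) * j) ≤
      l ! * c ^ l / ∏ j ∈ Finset.range (l + 1), (a + c * j) := by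
    intro l
    have h1 := h 1 l 0 0
    rw [Function.iterate_one, fwdDiff, add_comm 1 l, pow_succ,
      show ∀ x y : ℝ, (-1 : ℝ) ^ l * -1 * (x - y) = (-1) ^ l * y - (-1) ^ l * x by intros; ring,
      Prod.mk_add_mk, zero_add, add_zero, hrow, hrow] at h1
    simpa using h1
  -- For c = 0 there is no decay exponent a/c, but l = 1 already contradicts: the right side
  -- vanishes and the left does not.
  rcases hc.eq_or_lt with rfl | hc'
  · have := hle 1
    have hpos : 0 < ∏ j ∈ Finset.range (1 + 1), (a + b + (0 + d) * (j : ℝ)) :=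
      Finset.prod_pos fun j _ => by positivity
    rw [pow_one, pow_one, mul_zero, zero_div, zero_add] at this
    rw [zero_add] at hpos
    have h2 : 0 < ((1 ! : ℕ) : ℝ) * d / ∏ j ∈ Finset.range (1 + 1), (a + b + d * (j : ℝ)) := by
      positivity
    linarith
  -- M < 0 says that column 1 decays more slowly than column 0, so `hle` fails for large l.
  have hθ : (a + b) / (c + d) - a / c < 0 := by
    rw [sub_neg, div_lt_div_iff₀ (by positivity) hc']
    nlinarith
  set θ₁ := (a + b) / (c + d) with hθ₁
  set θ₀ := a / c with hθ₀
  have hlim0 : Tendsto (fun l : ℕ => (c + d) / c * Real.GammaSeq θ₀ l * (l : ℝ) ^ (θ₁ - θ₀)) atTop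
      (𝓝 ((c + d) / c * Real.Gamma θ₀ * 0)) := by
    refine ((Real.GammaSeq_tendsto_Gamma θ₀).const_mul _).mul ?_
    have := (tendsto_rpow_neg_atTop (neg_pos.2 hθ)).comp tendsto_natCast_atTop_atTop
    simpa [Function.comp_def] using this
  have hGle : Real.Gamma θ₁ ≤ (c + d) / c * Real.Gamma θ₀ * 0 := by
    refine le_of_tendsto_of_tendsto (Real.GammaSeq_tendsto_Gamma θ₁) hlim0 ?_
    filter_upwards [eventually_gt_atTop 0] with l hl
    have h1 := hle l
    rw [prod_linear_eq_gammaSeq (by positivity) (by positivity) hl,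
      prod_linear_eq_gammaSeq ha hc' hl] at h1
    have hl' : (0 : ℝ) < l := by exact_mod_cast hl
    rw [← hθ₁, ← hθ₀, div_le_iff₀ (by positivity)] at h1
    refine h1.trans_eq ?_
    rw [Real.rpow_sub hl']
    have : (0 : ℝ) < (l : ℝ) ^ θ₀ := by positivity
    field_simp
  have hθ₁pos : 0 < θ₁ := by positivity
  linarith [Real.Gamma_pos_of_pos hθ₁pos]

/-! ### Joint completely monotone functions -/

/-- With q = (c + dx)/(A + Bx) and r = 1/(A + Bx), q' = -M r² and r' = -B r². The truncated i - 1 is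
harmless, since its term carries the factor i. -/
theorem hasDerivAt_ratio_pow_mul_inv_pow {A B c d M x : ℝ} (hM : B * c - A * d = M)
    (hx : A + B * x ≠ 0) (i j : ℕ) :
    HasDerivAt (fun x => ((c + d * x) / (A + B * x)) ^ i * (1 / (A + B * x)) ^ j)
      (-(i * M * ((c + d * x) / (A + B * x)) ^ (i - 1) * (1 / (A + B * x)) ^ (j + 2) +
        j * B * ((c + d * x) / (A + B * x)) ^ i * (1 / (A + B * x)) ^ (j + 1))) x := by
  have hp : HasDerivAt (fun x => A + B * x) B x := by
    simpa using ((hasDerivAt_id x).const_mul B).const_add A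
  have hn : HasDerivAt (fun x => c + d * x) d x := by
    simpa using ((hasDerivAt_id x).const_mul d).const_add c
  have hq := (hn.div hp hx).pow i
  have hr := ((hasDerivAt_const x (1 : ℝ)).div hp hx).pow j
  refine (hq.mul hr).congr_deriv ?_
  have h1 : (d * (A + B * x) - (c + d * x) * B) / (A + B * x) ^ 2 =
      -M * (1 / (A + B * x)) ^ 2 := by
    rw [← hM, one_div_pow]
    ring
  have h2 : (0 * (A + B * x) - 1 * B) / (A + B * x) ^ 2 = -B * (1 / (A + B * x)) ^ 2 := by
    rw [one_div_pow]
    ring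
  simp only [Pi.div_apply, Pi.pow_apply, h1, h2]
  rcases j with _ | j
  · simp only [Nat.cast_zero, pow_zero]
    ring
  · rw [Nat.add_sub_cancel]
    ring

/-- The nonnegative combinations of the functions `q^i r^j`, where `q = (c + d x) / (A + B x)` and
`r = 1 / (A + B x)`. -/
def ratioCone (A B c d : ℝ) : AddSubmonoid (ℝ → ℝ) :=
  AddSubmonoid.closure {h | ∃ (κ : ℝ) (i j : ℕ), 0 ≤ κ ∧
    h = fun x => κ * (((c + d * x) / (A + B * x)) ^ i * (1 / (A + B * x)) ^ j)}

theorem mul_mem_ratioCone {A B c d κ : ℝ} (hκ : 0 ≤ κ) (i j : ℕ) :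
    (fun x => κ * (((c + d * x) / (A + B * x)) ^ i * (1 / (A + B * x)) ^ j)) ∈
      ratioCone A B c d :=
  AddSubmonoid.subset_closure ⟨κ, i, j, hκ, rfl⟩

theorem nonneg_of_mem_ratioCone {A B c d : ℝ} (hA : 0 < A) (hB : 0 ≤ B) (hc : 0 ≤ c)
    (hd : 0 ≤ d) {h : ℝ → ℝ} (hh : h ∈ ratioCone A B c d) {x : ℝ} (hx : 0 ≤ x) : 0 ≤ h x := by
  induction hh using AddSubmonoid.closure_induction with
  | mem h hmem =>
    obtain ⟨κ, i, j, hκ, rfl⟩ := hmem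
    positivity
  | zero => simp
  | add f g _ _ hf hg => exact add_nonneg hf hg

theorem exists_neg_deriv_mem_ratioCone {A B c d : ℝ} (hA : 0 < A) (hB : 0 ≤ B)
    (hM : 0 ≤ B * c - A * d) {h : ℝ → ℝ} (hh : h ∈ ratioCone A B c d) :
    ∃ h' ∈ ratioCone A B c d, ∀ x, 0 ≤ x → HasDerivAt h (-h' x) x := by
  induction hh using AddSubmonoid.closure_induction with
  | mem h hmem =>
    obtain ⟨κ, i, j, hκ, rfl⟩ := hmem
    refine ⟨_, add_mem (mul_mem_ratioCone (κ := κ * (i * (B * c - A * d))) (by positivity)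
        (i - 1) (j + 2)) (mul_mem_ratioCone (κ := κ * (j * B)) (by positivity) i (j + 1)),
      fun x hx => ?_⟩
    refine ((hasDerivAt_ratio_pow_mul_inv_pow rfl (by positivity) i j).const_mul κ).congr_deriv ?_
    simp only [Pi.add_apply]
    ring
  | zero => exact ⟨0, zero_mem _, fun x _ => by simp⟩
  | add f g _ _ hf hg =>
    obtain ⟨f', hf', hf⟩ := hf
    obtain ⟨g', hg', hg⟩ := hg
    exact ⟨f' + g', add_mem hf' hg', fun x hx => ((hf x hx).add (hg x hx)).congr_deriv (by
      simp only [Pi.add_apply]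
      ring)⟩

theorem derivWithin_Ici_eq {f g : ℝ → ℝ} {g' x : ℝ} (hfg : ∀ x, 0 ≤ x → f x = g x) (hx : 0 ≤ x)
    (hg : HasDerivAt g g' x) : derivWithin f (Ici 0) x = g' := by
  rw [derivWithin_congr (fun x (hx : x ∈ Ici 0) => hfg x hx) (hfg x hx)]
  exact hg.hasDerivWithinAt.derivWithin (uniqueDiffOn_Ici 0 x hx)

theorem partialFst_iterate_of_mem_ratioCone {A B c d y : ℝ} (hA : 0 < A) (hB : 0 ≤ B)
    (hM : 0 ≤ B * c - A * d) {F : ℝ × ℝ → ℝ} {h : ℝ → ℝ} (hh : h ∈ ratioCone A B c d) {σ : ℝ}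
    (hF : ∀ x, 0 ≤ x → F (x, y) = σ * h x) (k : ℕ) :
    ∃ h' ∈ ratioCone A B c d, ∀ x, 0 ≤ x → partialFst^[k] F (x, y) = (-1) ^ k * σ * h' x := by
  induction k with
  | zero => exact ⟨h, hh, by simpa using hF⟩
  | succ k ih =>
    obtain ⟨g, hg, hgF⟩ := ih
    obtain ⟨g', hg', hderiv⟩ := exists_neg_deriv_mem_ratioCone hA hB hM hg
    refine ⟨g', hg', fun x hx => ?_⟩
    rw [Function.iterate_succ_apply', partialFst,
      derivWithin_Ici_eq hgF hx ((hderiv x hx).const_mul _)]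
    ring

theorem partialSnd_iterate_inv_bidegOnePoly {a b c d : ℝ}
    (hp : ∀ x y : ℝ, 0 ≤ x → 0 ≤ y → 0 < bidegOnePoly a b c d x y) (l : ℕ) {x y : ℝ} (hx : 0 ≤ x)
    (hy : 0 ≤ y) :
    partialSnd^[l] (fun z => 1 / bidegOnePoly a b c d z.1 z.2) (x, y) =
      (-1) ^ l * l ! * (((c + d * x) / (a + c * y + (b + d * y) * x)) ^ l *
        (1 / (a + c * y + (b + d * y) * x)) ^ 1) := by
  have hpe : ∀ y, bidegOnePoly a b c d x y = a + b * x + (c + d * x) * y := fun y => by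
    rw [bidegOnePoly]
    ring
  have key : ∀ y, 0 ≤ y → partialSnd^[l] (fun z => 1 / bidegOnePoly a b c d z.1 z.2) (x, y) =
      -- The zeroth power of a zero ratio is a dummy factor 1, so that the derivative formula above
      -- applies with c = d = 0.
      (-1) ^ l * l ! * (c + d * x) ^ l * ((0 + 0 * y) / (a + b * x + (c + d * x) * y)) ^ 0 *
        (1 / (a + b * x + (c + d * x) * y)) ^ (l + 1) := by
    induction l with
    | zero => intro y _; simp [hpe]
    | succ l ih =>
      intro y hy
      have hpy := hp x y hx hy
      rw [hpe] at hpy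
      have hderiv := (hasDerivAt_ratio_pow_mul_inv_pow (c := 0) (d := 0) rfl hpy.ne' 0
        (l + 1)).const_mul ((-1) ^ l * l ! * (c + d * x) ^ l)
      rw [Function.iterate_succ_apply', partialSnd,
        derivWithin_Ici_eq (fun y hy => (ih y hy).trans (mul_assoc _ _ _)) hy hderiv,
        Nat.factorial_succ]
      push_cast
      ring
  rw [key y hy, show a + c * y + (b + d * y) * x = a + b * x + (c + d * x) * y by ring,
    div_eq_mul_one_div (c + d * x), mul_pow (c + d * x), pow_succ _ l]
  ring

theorem jointCompletelyMonotoneFun_inv_bidegOnePoly {a b c d : ℝ} (ha : 0 < a) (hb : 0 ≤ b)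
    (hc : 0 ≤ c) (hd : 0 ≤ d) (hp : ∀ x y : ℝ, 0 ≤ x → 0 ≤ y → 0 < bidegOnePoly a b c d x y)
    (hM : 0 ≤ b * c - a * d) :
    JointCompletelyMonotoneFun fun z => 1 / bidegOnePoly a b c d z.1 z.2 := by
  refine ⟨fun z hz => one_div_pos.2 (hp _ _ hz.1 hz.2), ?_, fun k l z hz => ?_⟩
  · refine contDiffOn_const.div ?_ fun z hz => (hp _ _ hz.1 hz.2).ne'
    unfold bidegOnePoly
    fun_prop
  · obtain ⟨x, y⟩ := z
    have hx : 0 ≤ x := hz.1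
    have hy : 0 ≤ y := hz.2
    -- For fixed y the determinant (b + dy)c - (a + cy)d equals M, whatever y is.
    obtain ⟨h, hh, hk⟩ := partialFst_iterate_of_mem_ratioCone (A := a + c * y) (B := b + d * y)
      (c := c) (d := d) (by positivity) (by positivity) (by linarith)
      (mul_mem_ratioCone zero_le_one l 1) (σ := (-1) ^ l * l !)
      (F := partialSnd^[l] fun z => 1 / bidegOnePoly a b c d z.1 z.2)
      (fun x hx => by rw [partialSnd_iterate_inv_bidegOnePoly hp l hx hy, one_mul]) k
    have := nonneg_of_mem_ratioCone (by positivity) (by positivity) hc hd hh hx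
    rw [hk x hx, pow_add, show ∀ u v w z : ℝ, u * v * (u * (v * w) * z) =
      (u * u) * (v * v) * (w * z) by intros; ring, ← mul_pow, ← mul_pow, neg_one_mul, neg_neg,
      one_pow, one_pow, one_mul, one_mul]
    positivity

theorem JointCompletelyMonotoneFun.det_nonneg {a b c d : ℝ} (ha : 0 < a) (hc : 0 ≤ c)
    (hp : ∀ x y : ℝ, 0 ≤ x → 0 ≤ y → 0 < bidegOnePoly a b c d x y)
    (h : JointCompletelyMonotoneFun fun z => 1 / bidegOnePoly a b c d z.1 z.2) :
    0 ≤ b * c - a * d := by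
  have key : ∀ l : ℕ, 0 ≤ l * (b * c - a * d) * (c / a) ^ (l - 1) * (1 / a) ^ 3 +
      b * (c / a) ^ l * (1 / a) ^ 2 := by
    intro l
    have h1 := h.2.2 1 l (0, 0) ⟨self_mem_Ici, self_mem_Ici⟩
    have hderiv := (hasDerivAt_ratio_pow_mul_inv_pow (A := a) (B := b) (c := c) (d := d) (x := 0)
      rfl (by simpa using ha.ne') l 1).const_mul ((-1) ^ l * (l ! : ℝ))
    rw [Function.iterate_one, partialFst, derivWithin_Ici_eq (fun x hx => by
      rw [partialSnd_iterate_inv_bidegOnePoly hp l hx le_rfl, mul_zero, mul_zero, add_zero,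
        add_zero]) le_rfl hderiv] at h1
    simp only [mul_zero, add_zero, Nat.cast_one, one_mul] at h1
    rw [add_comm 1 l, pow_succ, show ∀ u v : ℝ, (-1 : ℝ) ^ l * -1 * ((-1) ^ l * u * -v) =
      ((-1) * (-1)) ^ l * (u * v) by intros; rw [mul_pow]; ring] at h1
    rw [neg_one_mul, neg_neg, one_pow, one_mul] at h1
    exact nonneg_of_mul_nonneg_right h1 (by positivity)
  by_contra! hM
  rcases hc.eq_or_lt with rfl | hc'
  · have := key 1
    norm_num at this hM
    nlinarith [mul_pos hM (inv_pos.2 (pow_pos ha 3))]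
  · obtain ⟨l, hl⟩ := exists_nat_gt (b * c / -(b * c - a * d))
    rw [div_lt_iff₀ (neg_pos.2 hM)] at hl
    have h1 := key (l + 1)
    rw [Nat.add_sub_cancel, pow_succ (c / a) l] at h1
    have h2 : ((l + 1 : ℕ) : ℝ) * (b * c - a * d) * (c / a) ^ l * (1 / a) ^ 3 +
        b * ((c / a) ^ l * (c / a)) * (1 / a) ^ 2 =
        (c / a) ^ l * (1 / a) ^ 3 * ((l + 1) * (b * c - a * d) + b * c) := by
      push_cast
      field_simp
    rw [h2] at h1
    have := nonneg_of_mul_nonneg_right h1 (by positivity)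
    nlinarith

/-! ### Signs of the coefficients and conclusion -/

theorem coeff_nonneg_of_bidegOnePoly_pos {a b c d : ℝ}
    (hp : ∀ x y : ℝ, 0 ≤ x → 0 ≤ y → 0 < bidegOnePoly a b c d x y) :
    0 < a ∧ 0 ≤ b ∧ 0 ≤ c ∧ 0 ≤ d := by
  simp only [bidegOnePoly] at hp
  have ha : 0 < a := by simpa using hp 0 0 le_rfl le_rfl
  have hb : 0 ≤ b := by
    by_contra! hb
    have := hp (a / -b) 0 (div_nonneg ha.le (neg_pos.2 hb).le) le_rfl
    have h2 : b * (a / -b) = -a := by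
      have := hb.ne
      field_simp
    linarith
  have hc : 0 ≤ c := by
    by_contra! hc
    have := hp 0 (a / -c) le_rfl (div_nonneg ha.le (neg_pos.2 hc).le)
    have h2 : c * (a / -c) = -a := by
      have := hc.ne
      field_simp
    linarith
  refine ⟨ha, hb, hc, ?_⟩
  by_contra! hd
  have hd' := neg_pos.2 hd
  -- This choice gives p(t, t) = a(1 - t) + dt, which is negative because t ≥ 1 and d < 0.
  obtain ⟨t, ht⟩ : ∃ t, t = 1 + (a + b + c) / -d := ⟨_, rfl⟩
  have ht1 : 1 ≤ t := by
    have : 0 ≤ (a + b + c) / -d := by positivity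
    linarith
  have hdt : d * t = d - (a + b + c) := by
    have := hd.ne
    rw [ht]
    field_simp
    ring
  have := hp t t (by linarith) (by linarith)
  nlinarith

theorem exists_isRepresentingMeasure_inv_bidegOnePoly_pow {a b c d : ℝ}
    (hp : ∀ x y : ℝ, 0 ≤ x → 0 ≤ y → 0 < bidegOnePoly a b c d x y) (hM : 0 ≤ b * c - a * d)
    (q : ℕ) :
    ∃ μ, IsRepresentingMeasure (fun i => 1 / bidegOnePoly a b c d i.1 i.2 ^ (q + 1)) μ ∧
      ∀ᵐ z ∂μ, 0 < z.1 ∧ 0 < z.2 := by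
  obtain ⟨ha, hb, hc, hd⟩ := coeff_nonneg_of_bidegOnePoly_pos hp
  rcases hd.eq_or_lt with rfl | hd
  · refine ⟨_, ?_, ae_pos_powerCurveMeasure 1 a q b c⟩
    convert! isRepresentingMeasure_powerCurveMeasure zero_le_one ha hb hc q using 2 with i
    rw [bidegOnePoly]
    ring
  · have hbc : 0 < b * c := by nlinarith [mul_pos ha hd]
    exact ⟨_, isRepresentingMeasure_squareMeasure hd (pos_of_mul_pos_left hbc hc)
      (pos_of_mul_pos_right hbc hb) hp hM q, ae_pos_squareMeasure _⟩

theorem theorem3p1 (a b c d : ℝ)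
    (hp : ∀ x y : ℝ, 0 ≤ x → 0 ≤ y → 0 < bidegOnePoly a b c d x y) :
    [JointCompletelyMonotoneFun fun z => 1 / bidegOnePoly a b c d z.1 z.2,
      0 ≤ b * c - a * d,
      JointCompletelyMonotoneNet fun i => 1 / bidegOnePoly a b c d i.1 i.2,
      MinimalJointCompletelyMonotoneNet fun i => 1 / bidegOnePoly a b c d i.1 i.2].TFAE ∧
    (0 ≤ b * c - a * d → ∀ l : ℕ, 1 ≤ l →
      (MinimalJointCompletelyMonotoneNet fun i => 1 / bidegOnePoly a b c d i.1 i.2 ^ l) ∧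
      (d ≠ 0 → ∀ μ : Measure (ℝ × ℝ),
        IsRepresentingMeasure (fun i => 1 / bidegOnePoly a b c d i.1 i.2 ^ l) μ ↔
          μ = squareMeasure (bilinearWeight b c d (b * c - a * d) l)) ∧
      (b ≠ 0 → d = 0 → ∀ μ : Measure (ℝ × ℝ),
        IsRepresentingMeasure (fun i => 1 / bidegOnePoly a b c d i.1 i.2 ^ l) μ ↔
          μ = curveMeasure a b c l)) ∧
    (d ≠ 0 → 0 ≤ b * c - a * d → ∀ l : ℕ, 1 ≤ l → ∀ s ∈ Ioo (0 : ℝ) 1, ∀ t ∈ Ioo (0 : ℝ) 1,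
      Tendsto (fun M => bilinearWeight b c d M l s t) (𝓝[>] 0)
        (𝓝 (bilinearWeight b c d 0 l s t))) := by
  obtain ⟨ha, hb, hc, hd⟩ := coeff_nonneg_of_bidegOnePoly_pos hp
  have hmin : 0 ≤ b * c - a * d → ∀ q : ℕ,
      MinimalJointCompletelyMonotoneNet fun i => 1 / bidegOnePoly a b c d i.1 i.2 ^ (q + 1) := by
    intro hM q
    obtain ⟨μ, hμ, hpos⟩ := exists_isRepresentingMeasure_inv_bidegOnePoly_pow hp hM q
    exact hμ.minimalJointCompletelyMonotoneNet hpos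
  refine ⟨?_, fun hM l hl => ?_, fun hd0 _ l hl s hs t ht => ?_⟩
  · tfae_have 1 → 2 := fun h => h.det_nonneg ha hc hp
    tfae_have 2 → 1 := jointCompletelyMonotoneFun_inv_bidegOnePoly ha hb hc hd hp
    tfae_have 2 → 4 := fun hM => by simpa using hmin hM 0
    tfae_have 4 → 3 := fun h => h.1
    tfae_have 3 → 2 := fun h => h.det_nonneg ha hb hc
    tfae_finish
  · obtain ⟨q, rfl⟩ := Nat.exists_eq_add_of_le' hl
    refine ⟨hmin hM q, fun hd0 μ => ?_, fun hb0 hd0 μ => ?_⟩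
    · have hd' := hd.lt_of_ne' hd0
      have hbc : 0 < b * c := by nlinarith [mul_pos ha hd']
      have hrep := isRepresentingMeasure_squareMeasure hd' (pos_of_mul_pos_left hbc hc)
        (pos_of_mul_pos_right hbc hb) hp hM q
      exact ⟨fun h => h.eq hrep, fun h => h ▸ hrep⟩
    · subst hd0
      have hrep := isRepresentingMeasure_curveMeasure ha (hb.lt_of_ne' hb0) hc q
      exact ⟨fun h => h.eq hrep, fun h => h ▸ hrep⟩
  · obtain ⟨q, rfl⟩ := Nat.exists_eq_add_of_le' hl
    exact tendsto_bilinearWeight q hs ht
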